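/- All graphs are finite, simple and connected, and $d_H(u,v)$ denotes the distance in a graph $H$. A set $W$ of vertices of $H$ is a doubly resolving set for $H$ if for every two distinct vertices $u,v$ of $H$ there are $x,y\in W$ with $d_H(v,x)-d_H(u,x)\neq d_H(v,y)-d_H(u,y)$. A doubly resolving set for $H$ of minimum cardinality is called a doubly basis of $H$, and its cardinality is denoted by $\psi(H)$. A leaf is a vertex of degree $1$. Let $G$ be a unicyclic graph (a graph with exactly one cycle) that is not itself a cycle, let $C(G)$ be its unique cycle, and let $B$ be a doubly basis of the graph $C(G)$. If every vertex of $B$ has degree at least $3$ in $G$, then $\psi(G)=l(G)$, where $l(G)$ is the number of leaves of $G$. -/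

import Mathlib

namespace DoublyResolving

/-- The vertices `u, v` of `G` are doubly resolved by the vertices `x, y` of `G`:
`d(v,x) - d(u,x) ≠ d(v,y) - d(u,y)`, the differences being taken in `ℤ`. -/
def DoublyResolved {V : Type*} (G : SimpleGraph V) (u v x y : V) : Prop :=
  (G.dist v x : ℤ) - (G.dist u x : ℤ) ≠ (G.dist v y : ℤ) - (G.dist u y : ℤ)

/-- `W` is a doubly resolving set for `G`: every two distinct vertices of `G` are doubly
resolved by some two vertices of `W` (which are then automatically distinct). -/
def IsDoublyResolvingSet {V : Type*} (G : SimpleGraph V) (W : Finset V) : Prop :=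
  ∀ u v : V, u ≠ v → ∃ x ∈ W, ∃ y ∈ W, DoublyResolved G u v x y

/-- A doubly basis of `G`: a doubly resolving set for `G` of minimum cardinality. -/
def IsDoublyBasis {V : Type*} (G : SimpleGraph V) (B : Finset V) : Prop :=
  IsDoublyResolvingSet G B ∧ ∀ W : Finset V, IsDoublyResolvingSet G W → B.card ≤ W.card

/-- The doubly resolving number `ψ(G)`: the minimum cardinality of a doubly resolving set. -/
noncomputable def doublyResolvingNumber {V : Type*} (G : SimpleGraph V) : ℕ :=
  sInf {n : ℕ | ∃ W : Finset V, IsDoublyResolvingSet G W ∧ W.card = n}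

/-- The graph `G` is a cycle `C_n` for some `n ≥ 3`. -/
def IsCycleGraph {V : Type*} (G : SimpleGraph V) : Prop :=
  ∃ n : ℕ, 3 ≤ n ∧ Nonempty (G ≃g SimpleGraph.cycleGraph n)

/-- A graph with exactly one cycle, that is, exactly one subgraph that is a cycle. -/
def IsUnicyclic {V : Type*} (G : SimpleGraph V) : Prop :=
  ∃! C : G.Subgraph, IsCycleGraph C.coe

/-- The set of leaves of `G`, the vertices of degree `1`. -/
def leaves {V : Type*} [Fintype V] (G : SimpleGraph V) [DecidableRel G.Adj] : Finset V :=
  Finset.univ.filter fun v => G.degree v = 1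

end DoublyResolving

open SimpleGraph

namespace DoublyResolving

/-! Lower bound (`leaves_subset`): a leaf `v` with neighbour `y` is one step farther than `y` from
every other vertex, so only a set containing `v` can doubly resolve `v, y`.

Upper bound: the leaves doubly resolve. Every edge off `C` is a bridge, so `G` is `C` with trees
attached, and a leaf hangs off each vertex of `B`. If a path from `u` to `v`, or back, starts with
an edge off `C`, that bridge separates them; `B` has two elements, so both sides of the bridge
contain leaves, and one from each side resolves the pair. Otherwise `u, v` lie on `C`; a leaf
hanging off `b` sees `C` exactly as `b` does, up to an additive constant that cancels in the
differences, so leaves replace the vertices of `B`. -/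

/-- The subgraph traced by a cycle is a cycle graph. -/
theorem isCycleGraph_coe_toSubgraph {V : Type*} {G : SimpleGraph V} {u : V} {p : G.Walk u u}
    (hp : p.IsCycle) : IsCycleGraph p.toSubgraph.coe := by
  classical
  have hcyc : p.mapToSubgraph.IsCycle := by
    rw [← Walk.isCycle_map_iff_of_injective (f := p.toSubgraph.hom) Subgraph.hom_injective,
      Walk.map_mapToSubgraph_hom]
    exact hp
  have hlen : p.mapToSubgraph.length = p.length := by
    have h := congrArg Walk.length p.map_mapToSubgraph_hom
    exact (Walk.length_map _ _).symm.trans h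
  have h3 := hp.three_le_length
  obtain ⟨n, hn⟩ : ∃ n, p.length = n + 3 := ⟨p.length - 3, by lia⟩
  obtain ⟨f⟩ := (cycleGraph_isContained_iff (G := p.toSubgraph.coe) (n := n + 3) (by lia)).mpr
    ⟨_, p.mapToSubgraph, hcyc, hlen.trans hn⟩
  have hfin : Finite p.toSubgraph.verts := by
    rw [Walk.verts_toSubgraph]; exact p.support.finite_toSet
  have hcard : Nat.card p.toSubgraph.verts = n + 3 := by
    have h1 : p.toSubgraph.verts = (p.support.tail.toFinset : Set V) := by
      ext w
      rw [Walk.mem_verts_toSubgraph]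
      rw [List.coe_toFinset, Set.mem_ofPred_eq, Walk.mem_support_iff, or_iff_right_of_imp]
      rintro rfl
      exact Walk.end_mem_tail_support hp.not_nil
    rw [h1, Nat.card_coe_set_eq, Set.ncard_coe_finset, List.toFinset_card_of_nodup hp.support_nodup]
    simp [hn]
  have hbij : Function.Bijective f.toHom := by
    refine (Nat.bijective_iff_injective_and_card _).2 ⟨f.injective, ?_⟩
    rw [hcard, Nat.card_fin]
  refine ⟨n + 3, by lia, ⟨(RelIso.mk (Equiv.ofBijective _ hbij) ?_).symm⟩⟩
  intro a b
  refine ⟨fun hab ↦ ?_, fun hab ↦ f.toHom.map_adj hab⟩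
  -- Both graphs are 2-regular, so the images of the two neighbours of `a` exhaust the neighbours of
  -- its image: the bijection reflects adjacency.
  have h2 := hp.ncard_neighborSet_toSubgraph_eq_two
    (p.mem_verts_toSubgraph.1 (f.toHom a).2)
  have hsub : (fun i ↦ (f.toHom i : V)) '' ((cycleGraph (n + 3)).neighborFinset a : Set _) ⊆
      p.toSubgraph.neighborSet (f.toHom a : V) := by
    rintro _ ⟨i, hi, rfl⟩
    exact f.toHom.map_adj (by simpa using hi)
  have hinj : Function.Injective (fun i ↦ (f.toHom i : V)) :=
    Subtype.val_injective.comp hbij.1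
  have heq := Set.eq_of_subset_of_ncard_le hsub (by
    rw [h2, Set.ncard_image_of_injective _ hinj, Set.ncard_coe_finset, card_neighborFinset_eq_degree,
      cycleGraph_degree_three_le]) (Set.finite_of_ncard_ne_zero (by lia))
  have hmem : (f.toHom b : V) ∈ p.toSubgraph.neighborSet (f.toHom a : V) := hab
  rw [← heq] at hmem
  obtain ⟨i, hi, hib⟩ := hmem
  obtain rfl := hinj hib
  simpa using hi

/-- A cycle through the edge would trace a cycle subgraph different from `C`. -/
theorem isBridge_of_not_adj {V : Type*} {G : SimpleGraph V} (huni : IsUnicyclic G)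
    {C : G.Subgraph} (hC : IsCycleGraph C.coe) {a b : V} (hab : G.Adj a b) (hn : ¬ C.Adj a b) :
    G.IsBridge s(a, b) := by
  rw [isBridge_iff_forall_cycle_notMem hab]
  intro u p hp he
  have := huni.unique hC (isCycleGraph_coe_toSubgraph hp)
  rw [← Walk.mem_edges_toSubgraph, ← this] at he
  exact hn he

theorem IsCycleGraph.connected {V : Type*} {G : SimpleGraph V} (h : IsCycleGraph G) :
    G.Connected := by
  obtain ⟨n, hn, ⟨e⟩⟩ := h
  obtain ⟨n, rfl⟩ : ∃ m, n = m + 1 := ⟨n - 1, by lia⟩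
  exact e.connected_iff.2 cycleGraph_connected

theorem IsCycleGraph.nontrivial {V : Type*} {G : SimpleGraph V} (h : IsCycleGraph G) :
    Nontrivial V := by
  obtain ⟨n, hn, ⟨e⟩⟩ := h
  have : Nontrivial (Fin n) := Fin.nontrivial_iff_two_le.2 (by lia)
  exact e.toEquiv.nontrivial

theorem IsCycleGraph.ncard_neighborSet {V : Type*} {G : SimpleGraph V} (h : IsCycleGraph G)
    (v : V) : (G.neighborSet v).ncard = 2 := by
  obtain ⟨n, hn, ⟨e⟩⟩ := h
  obtain ⟨n, rfl⟩ : ∃ m, n = m + 3 := ⟨n - 3, by lia⟩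
  rw [← Nat.card_coe_set_eq, Nat.card_congr (e.mapNeighborSet v), Nat.card_coe_set_eq,
    ← coe_neighborFinset, Set.ncard_coe_finset, card_neighborFinset_eq_degree,
    cycleGraph_degree_three_le]

/-- A vertex of `G` of degree at least three has a neighbour off any given cycle subgraph. -/
theorem exists_adj_not_adj {V : Type*} [Fintype V] {G : SimpleGraph V} [DecidableRel G.Adj]
    {C : G.Subgraph} (hC : IsCycleGraph C.coe) (b : C.verts) (hb : 3 ≤ G.degree (b : V)) :
    ∃ w, G.Adj b w ∧ ¬ C.Adj b w := by
  by_contra! h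
  have h1 : G.neighborSet (b : V) ⊆ Subtype.val '' (C.coe.neighborSet b) := by
    intro w hw
    exact ⟨⟨w, (h w hw).snd_mem⟩, h w hw, rfl⟩
  have h2 := Set.ncard_le_ncard h1
  rw [Set.ncard_image_of_injective _ Subtype.val_injective, hC.ncard_neighborSet,
    ← coe_neighborFinset, Set.ncard_coe_finset, card_neighborFinset_eq_degree] at h2
  lia

/-- In a finite forest, every edge `q p` leads to a vertex with a single neighbour. -/
theorem exists_walk_to_end {V : Type*} [Finite V] {T : SimpleGraph V} (hT : T.IsAcyclic) {q p : V}
    (h : T.Adj q p) : ∃ x, ∃ w : T.Walk p x, q ∉ w.support ∧ ∃ y, ∀ z, T.Adj x z ↔ z = y := by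
  classical
  have := Fintype.ofFinite V
  by_contra! hcon
  -- Without such an end, a path from `p` avoiding `q` could always be extended, in the end beyond
  -- the number of vertices.
  have key : ∀ n : ℕ, ∃ x, ∃ w : T.Walk p x, w.IsPath ∧ q ∉ w.support ∧ w.length = n := by
    intro n
    induction n with
    | zero => exact ⟨p, .nil, by simp, by simpa using h.ne, rfl⟩
    | succ n ih =>
      obtain ⟨x, w, hw, hq, hl⟩ := ih
      have hpath : (Walk.cons h w).IsPath := hw.cons hq
      obtain ⟨z, hz⟩ := hcon x w hq (Walk.cons h w).penultimate
      have hadj := (Walk.adj_penultimate (p := Walk.cons h w) Walk.not_nil_cons).symm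
      have hz' : T.Adj x z ∧ z ≠ (Walk.cons h w).penultimate := by
        rcases hz with hz | ⟨hz, rfl⟩
        · exact hz
        · exact absurd hadj hz
      have hns : z ∉ (Walk.cons h w).support := fun hs ↦
        hz'.2 (hT.eq_penultimate_of_adj_end hpath hz'.1 hs)
      rw [Walk.support_cons, List.mem_cons, not_or] at hns
      refine ⟨z, w.concat hz'.1, hw.concat hns.2 hz'.1, ?_, by simp [hl]⟩
      simp only [Walk.support_concat, List.mem_append, List.mem_singleton,
        not_or]
      exact ⟨hq, fun e ↦ hns.1 e.symm⟩
  obtain ⟨x, w, hw, -, hl⟩ := key (Fintype.card V)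
  exact absurd hw.length_lt (by lia)

/-! ### Distances across a bridge -/

/-- A natural-valued function growing by at most one along edges grows at most by the distance. -/
theorem le_add_dist_of_adj {V : Type*} {G : SimpleGraph V} (hG : G.Connected) {h : V → ℕ}
    (hadj : ∀ a b, G.Adj a b → h b ≤ h a + 1) (a b : V) : h b ≤ h a + G.dist a b := by
  obtain ⟨w, hw⟩ := hG.exists_walk_length_eq_dist a b
  rw [← hw]
  clear hw
  induction w with
  | nil => simp
  | cons e w ih =>
    have := hadj _ _ e
    rw [Walk.length_cons]
    lia

theorem Adj.dist_le_dist_add_one {V : Type*} {G : SimpleGraph V} {u v w : V} (h : G.Adj v w)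
    (hr : G.Reachable u v) : G.dist u w ≤ G.dist u v + 1 := by
  obtain ⟨p, hp⟩ := hr.exists_walk_length_eq_dist
  rw [← hp, ← Walk.length_concat p h]
  exact dist_le _

/-- Distances between the two sides of a bridge. -/
theorem dist_add_one_add_dist_le {V : Type*} {G : SimpleGraph V} (hG : G.Connected) {p q x y : V}
    (hpq : G.IsBridge s(p, q)) (hx : (G.deleteEdges {s(p, q)}).Reachable x p)
    (hy : (G.deleteEdges {s(p, q)}).Reachable y q) :
    G.dist x p + 1 + G.dist q y ≤ G.dist x y := by
  classical
  rw [isBridge_iff] at hpq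
  set H := G.deleteEdges {s(p, q)} with hH
  -- The expected distance from `x`; growth by at most one per edge makes it a lower bound.
  let h : V → ℕ := fun w ↦ if H.Reachable w p then G.dist x w else G.dist x p + 1 + G.dist q w
  have hadj : ∀ a b, G.Adj a b → h b ≤ h a + 1 := by
    intro a b hab
    by_cases he : s(a, b) = s(p, q)
    · rw [Sym2.eq_iff] at he
      rcases he with ⟨rfl, rfl⟩ | ⟨rfl, rfl⟩
      · have : ¬ H.Reachable b a := fun hr ↦ hpq hr.symm
        simp [h, this]
      · have : ¬ H.Reachable a b := fun hr ↦ hpq hr.symm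
        simp [h, this]
        lia
    · have hr : H.Adj a b := by
        rw [hH, deleteEdges_adj]; exact ⟨hab, he⟩
      have h1 : H.Reachable a p ↔ H.Reachable b p :=
        ⟨hr.reachable.symm.trans, hr.reachable.trans⟩
      by_cases h2 : H.Reachable b p
      · simpa [h, h1, h2] using Adj.dist_le_dist_add_one hab (hG x a)
      · have := Adj.dist_le_dist_add_one hab (hG q a)
        simp only [h, h1, h2, if_false]
        lia
  have h1 := le_add_dist_of_adj hG hadj x y
  have h2 : ¬ H.Reachable y p := fun hr ↦ hpq (hr.symm.trans hy)
  simpa [h, hx, h2] using h1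

/-- Two vertices separated by a bridge are doubly resolved by any two vertices on its sides. -/
theorem doublyResolved_of_isBridge {V : Type*} {G : SimpleGraph V} (hG : G.Connected)
    {p q u v x y : V} (hpq : G.IsBridge s(p, q))
    (hu : (G.deleteEdges {s(p, q)}).Reachable u p) (hv : (G.deleteEdges {s(p, q)}).Reachable v q)
    (hx : (G.deleteEdges {s(p, q)}).Reachable x p) (hy : (G.deleteEdges {s(p, q)}).Reachable y q) :
    DoublyResolved G u v x y := by
  -- The difference at `x` is at least `d(v,q) - d(u,p) + 1`, the one at `y` at most `d(v,q) -
  -- d(u,p) - 1`.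
  have h1 := dist_add_one_add_dist_le hG hpq hx hv
  have h2 := dist_add_one_add_dist_le hG hpq hu hy
  have h3 := hG.dist_triangle (u := u) (v := p) (w := x)
  have h4 := hG.dist_triangle (u := v) (v := q) (w := y)
  have h5 := G.dist_comm (u := x) (v := v)
  have h6 := G.dist_comm (u := q) (v := v)
  have h7 := G.dist_comm (u := x) (v := p)
  unfold DoublyResolved
  lia

theorem DoublyResolved.swap {V : Type*} {G : SimpleGraph V} {u v x y : V} (h : DoublyResolved G u v x y) :
    DoublyResolved G v u x y := by
  unfold DoublyResolved at *
  lia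

/-- After deleting an edge of a connected graph, every vertex is connected to one of its ends. -/
theorem reachable_deleteEdges_or {V : Type*} {G : SimpleGraph V} (hG : G.Connected) (p q x : V) :
    (G.deleteEdges {s(p, q)}).Reachable x p ∨ (G.deleteEdges {s(p, q)}).Reachable x q := by
  suffices h : ∀ z, G.Walk x z → ((G.deleteEdges {s(p, q)}).Reachable z p ∨
      (G.deleteEdges {s(p, q)}).Reachable z q) → ((G.deleteEdges {s(p, q)}).Reachable x p ∨
      (G.deleteEdges {s(p, q)}).Reachable x q) from h p (hG x p).some (.inl .rfl)
  intro z w hz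
  induction w with
  | nil => exact hz
  | cons e w ih =>
    rename_i u v _
    by_cases he : s(u, v) = s(p, q)
    · rw [Sym2.eq_iff] at he
      rcases he with ⟨rfl, rfl⟩ | ⟨rfl, rfl⟩
      · exact .inl .rfl
      · exact .inr .rfl
    · have : (G.deleteEdges {s(p, q)}).Adj u v := deleteEdges_adj.2 ⟨e, he⟩
      exact (ih hz).imp this.reachable.trans this.reachable.trans

/-! ### The trees attached to the cycle -/

section Gate

variable {V : Type*} {G : SimpleGraph V} {C : G.Subgraph}

theorem reachable_deleteEdges_of_not_adj (hC : C.coe.Connected) {p q : V} (hn : ¬ C.Adj p q)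
    (a b : C.verts) : (G.deleteEdges {s(p, q)}).Reachable (a : V) b := by
  let f : C.coe →g G.deleteEdges {s(p, q)} :=
    { toFun := Subtype.val
      map_rel' := by
        intro x y hxy
        rw [deleteEdges_adj]
        refine ⟨C.adj_sub hxy, fun he ↦ hn ?_⟩
        rw [Set.mem_singleton_iff] at he
        rw [← Subgraph.mem_edgeSet, ← he]
        exact hxy }
  exact (hC a b).map f

theorem isAcyclic_sdiff (hbr : ∀ a b, G.Adj a b → ¬ C.Adj a b → G.IsBridge s(a, b)) :
    (G \ C.spanningCoe).IsAcyclic := by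
  rw [isAcyclic_iff_forall_adj_isBridge]
  intro a b hab
  exact IsBridge.anti sdiff_le (hbr a b hab.1 hab.2)

/-- Distinct vertices of `C` are not connected off the edges of `C`. -/
theorem eq_of_reachable_sdiff (hC : C.coe.Connected)
    (hbr : ∀ a b, G.Adj a b → ¬ C.Adj a b → G.IsBridge s(a, b)) {a b : C.verts}
    (h : (G \ C.spanningCoe).Reachable (a : V) b) : a = b := by
  obtain ⟨w, hw⟩ := h.exists_isPath
  obtain ⟨a, ha⟩ := a
  obtain ⟨b, hb⟩ := b
  cases w with
  | nil => rfl
  | cons e w =>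
    rw [Walk.cons_isPath_iff] at hw
    rename_i c
    refine absurd ?_ (isBridge_iff.1 (hbr a c e.1 e.2))
    refine (reachable_deleteEdges_of_not_adj hC e.2 ⟨a, ha⟩ ⟨b, hb⟩).trans ?_
    refine (reachable_deleteEdges_iff_exists_walk.2 ⟨w.mapLe sdiff_le, ?_⟩).symm
    intro hm
    rw [Walk.edges_mapLe_eq_edges] at hm
    exact hw.2 (Walk.fst_mem_support_of_mem_edges w hm)

/-- Follow a walk from `u` to `C` until its first edge of `C`. This provides the projection to `C`.
-/
theorem exists_reachable_sdiff (hG : G.Connected) (hC : C.coe.Connected) (u : V) :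
    ∃ c : C.verts, (G \ C.spanningCoe).Reachable (c : V) u := by
  obtain ⟨c₀⟩ := hC.nonempty
  obtain ⟨w⟩ := hG u c₀
  generalize hz : (c₀ : V) = z at w
  induction w with
  | nil => exact ⟨c₀, hz ▸ .rfl⟩
  | cons e w ih =>
    rename_i u v _
    obtain ⟨c, hc⟩ := ih hz
    by_cases h : C.Adj u v
    · exact ⟨⟨u, h.fst_mem⟩, .rfl⟩
    · exact ⟨c, hc.trans (Adj.reachable (G := G \ C.spanningCoe) ⟨e, h⟩).symm⟩

/-- Distances from the vertices of `C` to `x` are, up to a constant, the distances in `C` to the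
vertex `b` of `C` from which `x` branches off. -/
theorem exists_dist_eq_dist_add (hG : G.Connected) (hC : C.coe.Connected)
    (hbr : ∀ a b, G.Adj a b → ¬ C.Adj a b → G.IsBridge s(a, b)) {b : C.verts} {x : V}
    (hx : (G \ C.spanningCoe).Reachable (b : V) x) :
    ∃ k, ∀ c : C.verts, G.dist c x = C.coe.dist c b + k := by
  set F := G \ C.spanningCoe with hF
  choose π hπ using exists_reachable_sdiff hG hC
  have hπ' : ∀ (c : C.verts) u, F.Reachable (c : V) u → π u = c := fun c u h ↦
    eq_of_reachable_sdiff hC hbr ((hπ u).trans h.symm)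
  refine ⟨F.dist b x, fun c ↦ le_antisymm ?_ ?_⟩
  · refine (hG.dist_triangle (v := (b : V))).trans (add_le_add ?_ (hx.dist_anti sdiff_le))
    obtain ⟨w, hw⟩ := hC.exists_walk_length_eq_dist c b
    rw [← hw, ← Walk.length_map C.hom w]
    exact dist_le _
  -- An edge of `C` joins two fixed points of `π`; an edge off `C` leaves `π` unchanged. So only one
  -- summand varies.
  · have hadj : ∀ u v, G.Adj u v → C.coe.dist c (π v) + F.dist (π v : V) v ≤
        C.coe.dist c (π u) + F.dist (π u : V) u + 1 := by
      intro u v huv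
      by_cases h : C.Adj u v
      · rw [hπ' ⟨u, h.fst_mem⟩ u .rfl, hπ' ⟨v, h.snd_mem⟩ v .rfl, dist_self, dist_self]
        have h' : C.coe.Adj ⟨u, h.fst_mem⟩ ⟨v, h.snd_mem⟩ := h
        exact Adj.dist_le_dist_add_one h' (hC _ _)
      · have h' : F.Adj u v := ⟨huv, h⟩
        rw [hπ' (π u) v ((hπ u).trans h'.reachable), add_assoc]
        exact add_le_add_right (Adj.dist_le_dist_add_one h' (hπ u)) _
    have h := le_add_dist_of_adj hG hadj c x
    rwa [hπ' c c .rfl, hπ' b x hx, dist_self, dist_self, zero_add, zero_add] at h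

/-- Either `u` lies on `C` or a bridge at `u` off `C` separates it from `v`. -/
theorem mem_verts_or_exists_bridge (hG : G.Connected)
    {u v : V} (huv : u ≠ v) : u ∈ C.verts ∨ ∃ q, G.Adj u q ∧ ¬ C.Adj u q ∧
      (G.deleteEdges {s(u, q)}).Reachable v q := by
  obtain ⟨w, hw⟩ := hG.exists_isPath u v
  cases w with
  | nil => exact absurd rfl huv
  | cons e w =>
    rename_i q
    by_cases h : C.Adj u q
    · exact .inl h.fst_mem
    · rw [Walk.cons_isPath_iff] at hw
      refine .inr ⟨q, e, h, (reachable_deleteEdges_iff_exists_walk.2 ⟨w, ?_⟩).symm⟩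
      exact fun hm ↦ hw.2 (Walk.fst_mem_support_of_mem_edges w hm)

end Gate

/-! ### Leaves as a doubly resolving set -/

section Leaves

variable {V : Type*} [Fintype V] {G : SimpleGraph V} [DecidableRel G.Adj] {C : G.Subgraph}

theorem mem_leaves_iff {v : V} : v ∈ leaves G ↔ ∃ y, ∀ z, G.Adj v z ↔ z = y := by
  classical
  simp only [leaves, Finset.mem_filter, Finset.mem_univ, true_and, ← card_neighborFinset_eq_degree,
    Finset.card_eq_one, Finset.ext_iff, mem_neighborFinset, Finset.mem_singleton]

theorem mem_leaves_of_not_mem_verts {x : V} (hx : x ∉ C.verts)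
    (h : ∃ y, ∀ z, (G \ C.spanningCoe).Adj x z ↔ z = y) : x ∈ leaves G := by
  obtain ⟨y, hy⟩ := h
  exact mem_leaves_iff.2 ⟨y, fun z ↦ by
    rw [← hy z]; exact ⟨fun e ↦ ⟨e, fun hc ↦ hx hc.fst_mem⟩, fun e ↦ e.1⟩⟩

/-- A leaf hangs off every vertex of `C` that has a neighbour off `C`. -/
theorem exists_leaf_reachable_sdiff (hC : C.coe.Connected)
    (hbr : ∀ a b, G.Adj a b → ¬ C.Adj a b → G.IsBridge s(a, b)) (b : C.verts)
    (hb : ∃ w, G.Adj b w ∧ ¬ C.Adj b w) :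
    ∃ x ∈ leaves G, (G \ C.spanningCoe).Reachable (b : V) x := by
  obtain ⟨p, hp⟩ := hb
  have hp' : (G \ C.spanningCoe).Adj b p := hp
  obtain ⟨x, w, hw, hx⟩ := exists_walk_to_end (isAcyclic_sdiff hbr) hp'
  have hr := hp'.reachable.trans w.reachable
  refine ⟨x, mem_leaves_of_not_mem_verts (fun hxC ↦ hw ?_) hx, hr⟩
  have := eq_of_reachable_sdiff hC hbr (b := ⟨x, hxC⟩) hr
  rw [this]
  exact w.end_mem_support

/-- If leaves hang off two vertices of `C`, each side of every edge off `C` has a leaf. -/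
theorem exists_leaf_reachable_deleteEdges (hG : G.Connected) (hC : C.coe.Connected)
    (hbr : ∀ a b, G.Adj a b → ¬ C.Adj a b → G.IsBridge s(a, b)) {b₁ b₂ : C.verts} (hne : b₁ ≠ b₂)
    (h₁ : ∃ x ∈ leaves G, (G \ C.spanningCoe).Reachable (b₁ : V) x)
    (h₂ : ∃ x ∈ leaves G, (G \ C.spanningCoe).Reachable (b₂ : V) x)
    {p q : V} (hpq : G.Adj p q) (hn : ¬ C.Adj p q) :
    ∃ x ∈ leaves G, (G.deleteEdges {s(p, q)}).Reachable x p := by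
  set H := G.deleteEdges {s(p, q)} with hH
  by_cases hcp : H.Reachable (b₁ : V) p
  -- Here `C` lies on the side of `p`. Were `x₁` and `x₂` both on the other side, a walk there would
  -- join them off `C`, and hence `b₁` to `b₂`.
  · have hqside : ∀ x, H.Reachable x q → ∀ c : C.verts, ¬ H.Reachable x c := by
      intro x hx c hc
      exact isBridge_iff.1 (hbr p q hpq hn) (hcp.symm.trans
        ((reachable_deleteEdges_of_not_adj hC hn b₁ c).trans (hc.symm.trans hx)))
    have hor := reachable_deleteEdges_or hG p q
    obtain ⟨x₁, hx₁, hr₁⟩ := h₁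
    obtain ⟨x₂, hx₂, hr₂⟩ := h₂
    rcases hor x₁ with h | h₁
    · exact ⟨x₁, hx₁, h⟩
    rcases hor x₂ with h | h₂
    · exact ⟨x₂, hx₂, h⟩
    refine absurd (eq_of_reachable_sdiff hC hbr (hr₁.trans (Reachable.trans ?_ hr₂.symm))) hne
    obtain ⟨w⟩ := h₁.trans h₂.symm
    clear hr₁ hr₂ hx₁ hx₂
    induction w with
    | nil => exact .rfl
    | cons e w ih =>
      rename_i u v _
      have hv := e.reachable.symm.trans h₁
      have e' : (G \ C.spanningCoe).Adj u v :=
        ⟨(deleteEdges_adj.1 e).1, fun hc ↦ hqside u h₁ ⟨u, hc.fst_mem⟩ .rfl⟩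
      exact e'.reachable.trans (ih hv h₂)
  -- Here the side of `p` misses `C`, so a tree end reached from `p` without returning to `q` is a
  -- leaf of `G`.
  · have hqp : (G \ C.spanningCoe).Adj q p := ⟨hpq.symm, fun hc ↦ hn hc.symm⟩
    obtain ⟨x, w, hw, hx⟩ := exists_walk_to_end (isAcyclic_sdiff hbr) hqp
    have hr : H.Reachable x p := by
      refine (reachable_deleteEdges_iff_exists_walk.2 ⟨w.mapLe sdiff_le, ?_⟩).symm
      rw [Walk.edges_mapLe_eq_edges]
      exact fun hm ↦ hw (Walk.snd_mem_support_of_mem_edges w hm)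
    refine ⟨x, mem_leaves_of_not_mem_verts (fun hxC ↦ hcp ?_) hx, hr⟩
    exact (reachable_deleteEdges_of_not_adj hC hn b₁ ⟨x, hxC⟩).trans hr

theorem leaves_subset (hG : G.Connected) {W : Finset V} (hW : IsDoublyResolvingSet G W) :
    leaves G ⊆ W := by
  intro v hv
  obtain ⟨y, hy⟩ := mem_leaves_iff.1 hv
  have hvy : G.Adj v y := (hy y).2 rfl
  by_contra hvW
  have hd : ∀ x ∈ W, G.dist v x = G.dist y x + 1 := by
    intro x hx
    obtain ⟨w, hw⟩ := hG.exists_walk_length_eq_dist v x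
    refine le_antisymm ?_ ?_
    · have := hG.dist_triangle (u := v) (v := y) (w := x)
      rw [dist_eq_one_iff_adj.2 hvy] at this
      lia
    · rw [← hw]
      cases w with
      | nil => exact absurd hx hvW
      | cons e w =>
        obtain rfl := (hy _).1 e
        rw [Walk.length_cons]
        exact Nat.succ_le_succ (dist_le w)
  obtain ⟨x, hx, z, hz, h⟩ := hW v y hvy.ne
  apply h
  rw [hd x hx, hd z hz]
  push_cast
  ring

theorem isDoublyResolvingSet_leaves (hG : G.Connected) (hC : C.coe.Connected)
    (hbr : ∀ a b, G.Adj a b → ¬ C.Adj a b → G.IsBridge s(a, b)) [Nontrivial C.verts]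
    {B : Finset C.verts} (hB : IsDoublyResolvingSet C.coe B)
    (hleaf : ∀ b ∈ B, ∃ x ∈ leaves G, (G \ C.spanningCoe).Reachable (b : V) x) :
    IsDoublyResolvingSet G (leaves G) := by
  obtain ⟨b₁, hb₁, b₂, hb₂, hne⟩ : ∃ b₁ ∈ B, ∃ b₂ ∈ B, b₁ ≠ b₂ := by
    obtain ⟨c, d, hcd⟩ := exists_pair_ne C.verts
    obtain ⟨b₁, hb₁, b₂, hb₂, h⟩ := hB c d hcd
    exact ⟨b₁, hb₁, b₂, hb₂, fun e ↦ h (by rw [e])⟩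
  have hside : ∀ u v, (∃ q, G.Adj u q ∧ ¬ C.Adj u q ∧ (G.deleteEdges {s(u, q)}).Reachable v q) →
      ∃ x ∈ leaves G, ∃ y ∈ leaves G, DoublyResolved G u v x y := by
    rintro u v ⟨q, huq, hn, hv⟩
    obtain ⟨x, hx, hxu⟩ := exists_leaf_reachable_deleteEdges hG hC hbr hne (hleaf b₁ hb₁)
      (hleaf b₂ hb₂) huq hn
    obtain ⟨y, hy, hyq⟩ := exists_leaf_reachable_deleteEdges hG hC hbr hne (hleaf b₁ hb₁)
      (hleaf b₂ hb₂) huq.symm (fun h ↦ hn h.symm)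
    rw [Sym2.eq_swap] at hyq
    exact ⟨x, hx, y, hy, doublyResolved_of_isBridge hG (hbr u q huq hn) .rfl hv hxu hyq⟩
  intro u v huv
  rcases mem_verts_or_exists_bridge (C := C) hG huv with hu | h
  · rcases mem_verts_or_exists_bridge (C := C) hG huv.symm with hv | h
    · obtain ⟨c, hc, d, hd, h⟩ := hB ⟨u, hu⟩ ⟨v, hv⟩ (by simpa using huv)
      obtain ⟨x, hx, hxr⟩ := hleaf c hc
      obtain ⟨y, hy, hyr⟩ := hleaf d hd
      refine ⟨x, hx, y, hy, ?_⟩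
      obtain ⟨k, hk⟩ := exists_dist_eq_dist_add hG hC hbr hxr
      obtain ⟨l, hl⟩ := exists_dist_eq_dist_add hG hC hbr hyr
      have e₁ := hk ⟨u, hu⟩
      have e₂ := hk ⟨v, hv⟩
      have e₃ := hl ⟨u, hu⟩
      have e₄ := hl ⟨v, hv⟩
      unfold DoublyResolved at h ⊢
      lia
    · obtain ⟨x, hx, y, hy, h⟩ := hside v u h
      exact ⟨x, hx, y, hy, h.swap⟩
  · exact hside u v h

end Leaves

end DoublyResolving

/-- `C` is the unique cycle of the finite connected unicyclic graph `G`. Membership of `B` in the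
doubly bases of `C` refers to distances in `C`; the degrees of its vertices are taken in `G`. -/
theorem mainTheorem5 {V : Type*} [Fintype V] (G : SimpleGraph V) [DecidableRel G.Adj]
    (hconn : G.Connected) (huni : DoublyResolving.IsUnicyclic G)
    (hnot : ¬ DoublyResolving.IsCycleGraph G)
    (C : G.Subgraph) (hC : DoublyResolving.IsCycleGraph C.coe)
    (B : Finset C.verts) (hB : DoublyResolving.IsDoublyBasis C.coe B)
    (hdeg : ∀ b ∈ B, 3 ≤ G.degree (b : V)) :
    DoublyResolving.doublyResolvingNumber G = (DoublyResolving.leaves G).card := by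
  have hbr : ∀ a b, G.Adj a b → ¬ C.Adj a b → G.IsBridge s(a, b) := fun a b hab hn ↦
    DoublyResolving.isBridge_of_not_adj huni hC hab hn
  have := hC.nontrivial
  have hL := DoublyResolving.isDoublyResolvingSet_leaves hconn hC.connected hbr hB.1 fun b hb ↦
    DoublyResolving.exists_leaf_reachable_sdiff hC.connected hbr b
      (DoublyResolving.exists_adj_not_adj hC b (hdeg b hb))
  refine le_antisymm (Nat.sInf_le ⟨_, hL, rfl⟩) (le_csInf ⟨_, _, hL, rfl⟩ ?_)
  rintro _ ⟨W, hW, rfl⟩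
  exact Finset.card_le_card (DoublyResolving.leaves_subset hconn hW)
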